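/- Let $K$ be a differential field of characteristic zero with derivation $\partial$ and algebraically closed field of constants $C$. Let $C\{u\}=C[u,u',u'',\dots]$ be the ring of differential polynomials. Let $\partial^{-1}$ denote the formal antiderivative without constant term, and set $\mathrm{kdv}_0=u'$, $\mathrm{kdv}_n=\mathcal R(\mathrm{kdv}_{n-1})$, $v_0=1$, $v_n=\mathcal R^*(v_{n-1})$, where $\mathcal R=-\tfrac14\partial^2+u+\tfrac12u'\partial^{-1}$ and $\mathcal R^*=-\tfrac14\partial^2+u-\tfrac12\partial^{-1}u'$. With $L=-\partial^2+u$, let $P_1=\partial$ and $P_{2n+1}=v_n\partial-\tfrac12\partial(v_n)+P_{2n-1}L$ in $C\{u\}[\partial]$. For $c=(c_1,\dots,c_n)\in C^n$ put $$\mathbf{KdV}_n(u,c)=\mathrm{kdv}_n+\sum_{l=0}^{n-1}c_{n-l}\,\mathrm{kdv}_l,\qquad \hat P_{2n+1}(u,c)=P_{2n+1}+\sum_{l=0}^{n-1}c_{n-l}P_{2l+1}.$$ For operators $P,Q$ of orders $n,m$, let $\partial\mathrm{Res}(P,Q)$ be the determinant of the coefficient matrix of $\partial^{m-1}P,\dots,\partial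 P,P,\partial^{n-1}Q,\dots,\partial Q,Q$, with columns ordered by decreasing powers of $\partial$. The derivation is extended to polynomials in $\lambda,\mu$ by $\partial\lambda=\partial\mu=0$. If $\partial\mathrm{Res}(P-\lambda,Q-\mu)\in C[\lambda,\mu]$, the spectral curve of the pair $\{P,Q\}$ is the zero set in $C^2$ of its square-free part. Let $u_s\in K$ be a KdV potential of level $s$, that is, $s$ is the smallest integer $n\ge1$ such that $\mathbf{KdV}_n(u_s,c)=0$ for some $c\in C^n$. Let $\bar c\in C^s$ satisfy $\mathbf{KdV}_s(u_s,\bar c)=0$, and let $L_s=-\partial^2+u_s$ and $A_{2s+1}=\hat P_{2s+1}(u_s,\bar c)$ in $K[\partial]$. Then: 1. The differential resultant $f_s(\lambda,\mu)=\partial\mathrm{Res}(L_s-\lambda,A_{2s+1}-\mu)$ has constant coefficients and has the form $$f_s(\lambda,\mu)=-\mu^2-R_{2s+1}(\lambda),\qquad R_{2s+1}\in C[\lambda],\quad \deg R_{2s+1}=2s+1.$$ 2. The polynomial $f_s$ is irreducible in $K[\lambda,\mu]$, and the spectral curve $\Gamma_s$ of the pair $\{L_s,A_{2s+1}\}$ is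 $\{(\lambda,\mu)\in C^2 : f_s(\lambda,\mu)=0\}$. 3. For the differential indeterminate $u$ one has $$\partial\mathrm{Res}\bigl(L-\lambda,\hat P_{2s+1}(u,\bar c)-\mu\bigr)=-\mu^2-R_{2s+1}(u,\bar c,\lambda),\qquad R_{2s+1}(u,\bar c,\lambda)\in C\{u\}[\lambda].$$ The substitution $u=u_s$ sends $R_{2s+1}(u,\bar c,\lambda)$ to $R_{2s+1}(\lambda)$. Each coefficient $p\in C\{u\}$ of $R_{2s+1}(u,\bar c,\lambda)$ with respect to $\lambda$ is a first integral of $\mathbf{KdV}_s(u,\bar c)=0$: its derivative $\partial(p)$ belongs to the differential ideal of $C\{u\}$ generated by $\mathbf{KdV}_s(u,\bar c)$. -/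

import Mathlib

open scoped Polynomial

noncomputable section

namespace KdV

/-! ### Differential operators with coefficients in a differential ring

An element `∑ aᵢ ∂ⁱ` of the ring `E[∂]` is stored through its coefficients, as the polynomial
`∑ aᵢ Xⁱ : E[X]`.  The sum of operators is the sum of polynomials, the order is `natDegree`; the
product is *not* the product of polynomials but `opMul`, determined by `∂ a = a ∂ + d(a)`. -/

section DiffOp

variable {C E : Type*} [CommRing C] [CommRing E] [Algebra C E]

/-- The extension of a derivation of `E` to `E[X]` that acts on the coefficients (so `X` is a
constant). -/
def coeffDer (d : Derivation C E E) : Derivation C E[X] E[X] :=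
  (PolynomialModule.equivPolynomialSelf (R := E)).toLinearMap.compDer d.mapCoeffs

theorem coeff_coeffDer (d : Derivation C E E) (p : E[X]) (i : ℕ) :
    (coeffDer d p).coeff i = d (p.coeff i) := rfl

/-- The product `∂ · Q` in `E[∂]`: `∂ ∑ bⱼ ∂ʲ = ∑ bⱼ ∂ʲ⁺¹ + ∑ d(bⱼ) ∂ʲ`. -/
def delMul (d : Derivation C E E) (Q : E[X]) : E[X] :=
  Polynomial.X * Q + coeffDer d Q

/-- The product `P · Q` in `E[∂]`: `(∑ aᵢ ∂ⁱ) Q = ∑ aᵢ (∂ⁱ Q)`. -/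
def opMul (d : Derivation C E E) (P Q : E[X]) : E[X] :=
  P.sum fun i a => Polynomial.C a * (delMul d)^[i] Q

/-- The Sylvester matrix of operators `P`, `Q` of orders `n`, `m`: the coefficient matrix of
`∂ᵐ⁻¹P, …, ∂P, P, ∂ⁿ⁻¹Q, …, ∂Q, Q`, with columns indexed by `∂ᵐ⁺ⁿ⁻¹, …, ∂, 1`. -/
def sylvester (d : Derivation C E E) (n m : ℕ) (P Q : E[X]) :
    Matrix (Fin (m + n)) (Fin (m + n)) E :=
  Matrix.of fun i j =>
    (Fin.addCases (motive := fun _ => E[X])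
      (fun k : Fin m => (delMul d)^[(k.rev : ℕ)] P)
      (fun k : Fin n => (delMul d)^[(k.rev : ℕ)] Q) i).coeff (j.rev : ℕ)

/-- The differential resultant `∂Res(P, Q)`. -/
def dRes (d : Derivation C E E) (P Q : E[X]) : E :=
  (sylvester d P.natDegree Q.natDegree P Q).det

/-- `∂Res(P - λ, Q - μ)`, as an element of `E[λ, μ]`.  Here `E[λ, μ]` is `E[X][X]`, where `λ` is
the inner variable `C X` and `μ` is the outer variable `X`, and its derivation acts on the
coefficients. -/
def specRes (d : Derivation C E E) (P Q : E[X]) : E[X][X] :=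
  dRes (coeffDer (coeffDer d))
    (P.map (Polynomial.C.comp Polynomial.C) - Polynomial.C (Polynomial.C Polynomial.X))
    (Q.map (Polynomial.C.comp Polynomial.C) - Polynomial.C Polynomial.X)

end DiffOp

/-- `f` is a square-free part of `g`: it is square-free, with the same irreducible factors as `g`. -/
def IsSquarefreePart {A : Type*} [CommRing A] (f g : A) : Prop :=
  Squarefree f ∧ ∀ q : A, Irreducible q → (q ∣ f ↔ q ∣ g)

/-- The spectral curve of the pair `P`, `Q` of operators over `K`, a subset of the plane over the
field `C` of constants: the zero set of the square-free part `f` of `∂Res(P - λ, Q - μ)`, where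
the latter is seen as an element `g` of `C[λ, μ]`.  (`f` is unique up to a unit.) -/
def spectralCurve {C K : Type*} [Field C] [Field K] [Algebra C K] (d : Derivation C K K)
    (P Q : K[X]) : Set (C × C) :=
  {p | ∃ f g : C[X][X],
    g.map (Polynomial.mapRingHom (algebraMap C K)) = specRes d P Q ∧
    IsSquarefreePart f g ∧ f.evalEval p.1 p.2 = 0}

/-! ### The KdV hierarchy over the ring of differential polynomials -/

section Hierarchy

variable (C : Type*) [Field C]

/-- The ring `C{u} = C[u, u', u'', …]`; the variable `X i` is the derivative `u⁽ⁱ⁾`. -/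
abbrev DPoly := MvPolynomial ℕ C

/-- The derivation of `C{u}`: `u⁽ⁱ⁾ ↦ u⁽ⁱ⁺¹⁾`, zero on `C`. -/
def D : Derivation C (DPoly C) (DPoly C) :=
  MvPolynomial.mkDerivation C fun i => MvPolynomial.X (i + 1)

/-- The differential indeterminate `u`. -/
def U : DPoly C := MvPolynomial.X 0

variable {C}

open Classical in
/-- The formal integral `∂⁻¹ f` in `C{u}`: the antiderivative of `f` without constant term (and
`0` when `f` is not a total derivative, which does not occur in the recursions below). -/
def integral (f : DPoly C) : DPoly C :=
  if h : ∃ g : DPoly C, D C g = f ∧ MvPolynomial.constantCoeff g = 0 then h.choose else 0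

/-- The recursion operator `-(1/4) ∂² + u + (1/2) u' ∂⁻¹`. -/
def recOp (f : DPoly C) : DPoly C :=
  -((1 / 4 : C) • D C (D C f)) + U C * f + (1 / 2 : C) • (D C (U C) * integral f)

/-- The adjoint recursion operator `-(1/4) ∂² + u - (1/2) ∂⁻¹ u'`. -/
def recOpAdj (f : DPoly C) : DPoly C :=
  -((1 / 4 : C) • D C (D C f)) + U C * f - (1 / 2 : C) • integral (D C (U C) * f)

variable (C) in
/-- `kdv₀ = u'`, `kdvₙ = R(kdvₙ₋₁)`. -/
def kdv : ℕ → DPoly C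
  | 0 => D C (U C)
  | n + 1 => recOp (kdv n)

variable (C) in
/-- `v₀ = 1`, `vₙ = R*(vₙ₋₁)`. -/
def v : ℕ → DPoly C
  | 0 => 1
  | n + 1 => recOpAdj (v n)

/-- The Schrödinger operator `L = -∂² + w`, over any ring. -/
def schrodinger {E : Type*} [CommRing E] (w : E) : E[X] :=
  -(Polynomial.X ^ 2) + Polynomial.C w

variable (C) in
/-- The operators `P₂ₙ₊₁` over `C{u}`: `P₁ = ∂` and
`P₂ₙ₊₁ = vₙ ∂ - (1/2) ∂(vₙ) + P₂ₙ₋₁ L`. -/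
def opP : ℕ → (DPoly C)[X]
  | 0 => Polynomial.X
  | n + 1 =>
      Polynomial.C (v C (n + 1)) * Polynomial.X
        - Polynomial.C ((1 / 2 : C) • D C (v C (n + 1)))
        + opMul (D C) (opP n) (schrodinger (U C))

/-- `KdVₙ(u, c) = kdvₙ + ∑_{l < n} cₙ₋ₗ kdvₗ`, for constants `(c₁, …, cₙ)`; with `c : Fin n → C`
indexed from `0`, the constant `cₙ₋ₗ` is `c (Fin.rev l)`. -/
def KdVPoly {n : ℕ} (c : Fin n → C) : DPoly C :=
  kdv C n + ∑ l : Fin n, c l.rev • kdv C l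

/-- The operator `P₂ₙ₊₁ + ∑_{l < n} cₙ₋ₗ P₂ₗ₊₁` over `C{u}`. -/
def opPhat {n : ℕ} (c : Fin n → C) : (DPoly C)[X] :=
  opP C n + ∑ l : Fin n, c l.rev • opP C l

/-- `p ∈ C{u}` is a first integral of the differential equation `F = 0`: its derivative `∂(p)`
vanishes modulo the differential ideal `[F]`, generated by all derivatives of `F`. -/
def IsFirstIntegral (F p : DPoly C) : Prop :=
  D C p ∈ Ideal.span (Set.range fun j : ℕ => (D C)^[j] F)

end Hierarchy

/-! ### Specialization to a potential in a differential field -/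

section Potential

variable {C K : Type*} [Field C] [Field K] [Algebra C K]

/-- The substitution `u ↦ w` in differential polynomials, `u⁽ⁱ⁾ ↦ dⁱ(w)`. -/
def subst (d : Derivation C K K) (w : K) : DPoly C →ₐ[C] K :=
  MvPolynomial.aeval fun i => d^[i] w

/-- The set `Hₙ` of `c ∈ Cⁿ` with `KdVₙ(w, c) = 0`. -/
def solutionConstants (d : Derivation C K K) (w : K) (n : ℕ) : Set (Fin n → C) :=
  {c | subst d w (KdVPoly c) = 0}

/-- `w` is a KdV potential of level `s`: `s` is the smallest `n ≥ 1` with `Hₙ ≠ ∅`. -/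
def IsKdVPotential (d : Derivation C K K) (w : K) (s : ℕ) : Prop :=
  IsLeast {n : ℕ | 1 ≤ n ∧ (solutionConstants d w n).Nonempty} s

/-- The operator over `K` obtained by substituting `u ↦ w` in the coefficients of `opPhat c`. -/
def opA (d : Derivation C K K) (w : K) {n : ℕ} (c : Fin n → C) : K[X] :=
  (opPhat c).map (subst d w : DPoly C →+* K)

end Potential

end KdV

end

namespace KdV

/-! ### The Lenard recursion in the ring of differential polynomials -/

section Hierarchy

variable {C : Type*} [Field C]

/-! Put `F = ∑ vₖ λⁿ⁻ᵏ`, completed by the same combination of lower levels that defines the operator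
`P̂` of order `2n+1`. Modulo left multiples of `L - λ`, `P̂` is congruent to the first-order
operator `F ∂ - F'/2` (`map_opPhat_sub_mem`). For an operator `P` of order two, row reduction turns
`∂Res(P, Q)` into a power of the leading coefficient of `P` times the 2×2 determinant of the
remainders of `∂Q` and `Q` (`dRes_eq_of_remainders`). For the pair `L - λ`, `P̂ - μ` this gives `-μ²
- R` with `R = FF''/2 - F'²/4 - (u - λ)F²`.

The derivative of `R` is `-2F` times `-F'''/4 + (u - λ)F' + u'F/2` (`coeffDer_curvePoly`). The
Lenard recursion `D_v_succ` makes the powers of `λ` telescope, so twice the second factor is the KdV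
polynomial (`lenardPoly_vPolyHat`). Hence `∂R = -F · KdV`: the coefficients of `R` are first
integrals, and at a potential that solves the equation they are constants of `K`, so they lie in
`C`. Since `F` is monic of degree `n` in `λ`, `R` is monic of odd degree `2n+1`. So `-R` is not a
square, and `-μ² - R` is irreducible over both `C` and `K`.

The recursion itself requires each `u' vₙ` to be a total derivative, since the formal integral is
otherwise `0`. This is also proved in `D_v_succ`. -/

theorem D_X (i : ℕ) : D C (MvPolynomial.X i) = MvPolynomial.X (i + 1) := by
  simp [D]

theorem constantCoeff_D (f : DPoly C) : MvPolynomial.constantCoeff (D C f) = 0 := by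
  induction f using MvPolynomial.induction_on with
  | C a => simp [D]
  | add p q hp hq => simp [hp, hq]
  | mul_X p i hp => simp [hp, D_X]

/-- The commutator of `∂/∂u⁽ⁿ⁺¹⁾` with the derivation is `∂/∂u⁽ⁿ⁾`. It lets the vanishing of partial
derivatives descend in `n`. -/
theorem pderiv_succ_D (n : ℕ) (f : DPoly C) :
    MvPolynomial.pderiv (n + 1) (D C f) =
      D C (MvPolynomial.pderiv (n + 1) f) + MvPolynomial.pderiv n f := by
  induction f using MvPolynomial.induction_on with
  | C a => simp [D]
  | add p q hp hq => simp only [map_add, hp, hq]; ring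
  | mul_X p i hp =>
    have key : MvPolynomial.pderiv (n + 1) (MvPolynomial.X (i + 1) : DPoly C) =
        MvPolynomial.pderiv n (MvPolynomial.X i) := by
      by_cases h : i = n
      · subst h; simp
      · rw [MvPolynomial.pderiv_X_of_ne h, MvPolynomial.pderiv_X_of_ne (by omega)]
    have key2 : D C (MvPolynomial.pderiv (n + 1) (MvPolynomial.X i : DPoly C)) = 0 := by
      by_cases h : i = n + 1
      · subst h; simp
      · rw [MvPolynomial.pderiv_X_of_ne h]; simp
    simp only [Derivation.leibniz, map_add, hp, D_X, smul_eq_mul, key, key2]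
    ring

/-- In characteristic zero, the constants of `C{u}` are the elements of `C`. -/
theorem eq_C_of_D_eq_zero [CharZero C] {f : DPoly C} (hf : D C f = 0) :
    f = MvPolynomial.C (MvPolynomial.constantCoeff f) := by
  have step (n : ℕ) (h : MvPolynomial.pderiv (n + 1) f = 0) : MvPolynomial.pderiv n f = 0 := by
    have := pderiv_succ_D n f
    simpa [hf, h] using this.symm
  have all (n : ℕ) : MvPolynomial.pderiv n f = 0 := by
    -- Only finitely many variables occur in `f`, so the partial derivatives vanish from some index
    -- on; `step` then descends from there to every index.
    obtain ⟨N, hN⟩ : ∃ N, ∀ i ∈ f.vars, i < N :=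
      ⟨f.vars.sup id + 1, fun i hi => Nat.lt_succ_of_le (Finset.le_sup (f := id) hi)⟩
    by_cases h : N ≤ n
    · exact MvPolynomial.pderiv_eq_zero_of_notMem_vars fun hm => by have := hN n hm; omega
    · refine Nat.decreasingInduction (n := N) (motive := fun k _ => MvPolynomial.pderiv k f = 0)
        (fun k _ hk => step k hk) ?_ (by omega)
      exact MvPolynomial.pderiv_eq_zero_of_notMem_vars fun hm => by have := hN N hm; omega
  ext m
  rw [MvPolynomial.coeff_C]
  split_ifs with hm
  · subst hm; rfl
  · obtain ⟨i, hi⟩ : ∃ i, m i ≠ 0 := by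
      by_contra! h
      exact hm (Finsupp.ext fun i => (h i).symm)
    have h0 : MvPolynomial.coeff (m - Finsupp.single i 1) (MvPolynomial.pderiv i f) = 0 := by
      rw [all i]; simp
    have hmi : m - Finsupp.single i 1 + Finsupp.single i 1 = m :=
      tsub_add_cancel_of_le (by
        rw [Finsupp.single_le_iff]; omega)
    rw [MvPolynomial.coeff_pderiv, hmi] at h0
    rcases mul_eq_zero.1 h0 with h | h
    · exact h
    · exfalso; norm_cast at h

theorem constantCoeff_integral (f : DPoly C) :
    MvPolynomial.constantCoeff (integral f) = 0 := by
  unfold integral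
  split_ifs with h
  · exact h.choose_spec.2
  · simp

/-- Removing the constant term of `g` produces an admissible antiderivative, so the default value is
not taken on total derivatives. -/
theorem D_integral (g : DPoly C) : D C (integral (D C g)) = D C g := by
  have h : ∃ g' : DPoly C, D C g' = D C g ∧ MvPolynomial.constantCoeff g' = 0 :=
    ⟨g - MvPolynomial.C (MvPolynomial.constantCoeff g), by simp [D], by simp⟩
  rw [integral, dif_pos h]
  exact h.choose_spec.1

theorem integral_D [CharZero C] {g : DPoly C} (hg : MvPolynomial.constantCoeff g = 0) :
    integral (D C g) = g := by
  have h : D C (integral (D C g) - g) = 0 := by rw [map_sub, D_integral, sub_self]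
  have := eq_C_of_D_eq_zero h
  rw [map_sub, constantCoeff_integral, hg, sub_zero, map_zero] at this
  exact sub_eq_zero.1 this

/-- The third order operator `-(1/4) ∂³ + u ∂ + (1/2) u'`, which is `R ∂ = ∂ R*`. -/
noncomputable def lenard (f : DPoly C) : DPoly C :=
  -((1 / 4 : C) • D C (D C (D C f))) + U C * D C f + (1 / 2 : C) • (D C (U C) * f)

theorem constantCoeff_v_succ (n : ℕ) : MvPolynomial.constantCoeff (v C (n + 1)) = 0 := by
  simp [v, recOpAdj, constantCoeff_D, constantCoeff_integral, U]

/-- Since `∂(-f''/4 + u f) - lenard f = u'f/2`, exactness of `lenard f` is equivalent to exactness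
of `u'f`, which is what the integral in `recOpAdj` needs. -/
theorem D_recOpAdj [CharZero C] {f g : DPoly C} (hg : D C g = lenard f) :
    D C (recOpAdj f) = lenard f := by
  have h : D C (U C) * f = D C ((2 : C) • (-((1 / 4 : C) • D C (D C f)) + U C * f - g)) := by
    rw [Derivation.map_smul, map_sub, hg, map_add, map_neg, Derivation.map_smul, lenard,
      Derivation.leibniz]
    simp only [smul_eq_mul, mul_comm f]
    module
  rw [recOpAdj, map_sub, Derivation.map_smul, h, D_integral, ← h, lenard, map_add, map_neg,
    Derivation.map_smul, Derivation.leibniz]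
  simp only [smul_eq_mul, mul_comm f]
  module

theorem sum_antidiagonal_comm {A : Type*} [CommRing A] (a b : ℕ → A) (n : ℕ) :
    ∑ p ∈ Finset.HasAntidiagonal.antidiagonal n, a p.1 * b p.2 = ∑ p ∈ Finset.HasAntidiagonal.antidiagonal n, b p.1 * a p.2 := by
  rw [← Finset.Nat.sum_antidiagonal_swap]
  simp [mul_comm]

/-- The recursion `∂ vₙ₊₁ = (-(1/4) ∂³ + u ∂ + (1/2) u') vₙ`. -/
theorem D_v_succ [CharZero C] (n : ℕ) : D C (v C (n + 1)) = lenard (v C n) := by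
  induction n using Nat.strong_induction_on with
  | _ n ih =>
    rcases n with _ | n
    · refine D_recOpAdj (g := (1 / 2 : C) • U C) ?_
      simp [v, lenard]
    -- Exactness of `lenard vₙ₊₁`. The operator `lenard` is skew-adjoint, so `2 ∑ vᵢ lenard(vⱼ)`
    -- over `i + j = n + 1` is the derivative of `q`. By induction the terms with `i ≥ 1` are `vᵢ
    -- ∂vⱼ₊₁`, and twice their sum is the derivative of `r`. What remains is the term `i = 0`,
    -- namely `lenard vₙ₊₁` itself, because `v₀ = 1`.
    · let q : DPoly C := ∑ p ∈ Finset.HasAntidiagonal.antidiagonal (n + 1),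
        (-((1 / 2 : C) • (v C p.1 * D C (D C (v C p.2)))) +
          (1 / 4 : C) • (D C (v C p.1) * D C (v C p.2)) + U C * (v C p.1 * v C p.2))
      let r : DPoly C := ∑ p ∈ Finset.HasAntidiagonal.antidiagonal n, v C (p.1 + 1) * v C (p.2 + 1)
      have hq : D C q = (2 : C) • ∑ p ∈ Finset.HasAntidiagonal.antidiagonal (n + 1),
          v C p.1 * lenard (v C p.2) := by
        have h1 := sum_antidiagonal_comm (fun i => D C (v C i)) (fun i => D C (D C (v C i))) (n + 1)
        have h2 := sum_antidiagonal_comm (fun i => D C (v C i)) (fun i => v C i) (n + 1)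
        have e1 : D C q = ∑ p ∈ Finset.HasAntidiagonal.antidiagonal (n + 1),
            (-((1 / 2 : C) • (v C p.1 * D C (D C (D C (v C p.2))))) +
              D C (U C) * (v C p.1 * v C p.2)) -
            (1 / 4 : C) • ∑ p ∈ Finset.HasAntidiagonal.antidiagonal (n + 1), D C (v C p.1) * D C (D C (v C p.2)) +
            (1 / 4 : C) • ∑ p ∈ Finset.HasAntidiagonal.antidiagonal (n + 1), D C (D C (v C p.1)) * D C (v C p.2) +
            U C * ∑ p ∈ Finset.HasAntidiagonal.antidiagonal (n + 1), D C (v C p.1) * v C p.2 +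
            U C * ∑ p ∈ Finset.HasAntidiagonal.antidiagonal (n + 1), v C p.1 * D C (v C p.2) := by
          simp only [q, map_sum, Finset.smul_sum, Finset.mul_sum, ← Finset.sum_add_distrib,
            ← Finset.sum_sub_distrib]
          refine Finset.sum_congr rfl fun p _ => ?_
          simp only [map_add, map_neg, Derivation.map_smul, Derivation.leibniz, smul_eq_mul,
            mul_comm (D C (v C p.2)), mul_comm (D C (D C (v C p.2)))]
          rw [mul_comm (v C p.2) (D C (v C p.1)), mul_comm (v C p.1 * v C p.2) (D C (U C)), mul_add (U C)]
          module
        rw [e1, ← h1, h2, sub_add_cancel]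
        simp only [Finset.smul_sum, Finset.mul_sum, ← Finset.sum_add_distrib]
        refine Finset.sum_congr rfl fun p _ => ?_
        simp only [lenard, mul_add, mul_neg, mul_smul_comm]
        rw [mul_left_comm (v C p.1) (U C), mul_left_comm (v C p.1) (D C (U C))]
        module
      have hr : D C r = (2 : C) • ∑ p ∈ Finset.HasAntidiagonal.antidiagonal n,
          v C (p.1 + 1) * lenard (v C p.2) := by
        have h := sum_antidiagonal_comm (fun i => D C (v C (i + 1))) (fun i => v C (i + 1)) n
        have e1 : D C r = ∑ p ∈ Finset.HasAntidiagonal.antidiagonal n, v C (p.1 + 1) * D C (v C (p.2 + 1)) +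
            ∑ p ∈ Finset.HasAntidiagonal.antidiagonal n, D C (v C (p.1 + 1)) * v C (p.2 + 1) := by
          simp only [r, map_sum, ← Finset.sum_add_distrib]
          refine Finset.sum_congr rfl fun p _ => ?_
          rw [Derivation.leibniz, smul_eq_mul, smul_eq_mul, mul_comm (v C (p.2 + 1))]
        rw [e1, h, two_smul]
        have e2 : ∑ p ∈ Finset.HasAntidiagonal.antidiagonal n, v C (p.1 + 1) * D C (v C (p.2 + 1)) =
            ∑ p ∈ Finset.HasAntidiagonal.antidiagonal n, v C (p.1 + 1) * lenard (v C p.2) := by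
          refine Finset.sum_congr rfl fun p hp => ?_
          rw [ih p.2 (by have := Finset.HasAntidiagonal.mem_antidiagonal.1 hp; omega)]
        rw [e2]
      refine D_recOpAdj (g := (1 / 2 : C) • (q - r)) ?_
      rw [Derivation.map_smul, map_sub, hq, hr, Finset.Nat.sum_antidiagonal_succ, ← smul_sub,
        add_sub_cancel_right, smul_smul]
      simp [v]

/-- Because `vₙ₊₁` has no constant term, integrating `kdvₙ = 2 ∂vₙ₊₁` returns exactly `2 vₙ₊₁`, and
both recursions become the one given by `lenard`. -/
theorem kdv_eq [CharZero C] (n : ℕ) : kdv C n = (2 : C) • D C (v C (n + 1)) := by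
  induction n with
  | zero =>
    rw [D_v_succ]
    simp [kdv, lenard, v]
  | succ n ih =>
    have h : integral (kdv C n) = (2 : C) • v C (n + 1) := by
      rw [ih, ← Derivation.map_smul]
      exact integral_D (by simp [constantCoeff_v_succ])
    rw [kdv, recOp, h, D_v_succ (n + 1), ih, lenard]
    simp only [Derivation.map_smul, mul_smul_comm]
    module

end Hierarchy

/-! ### Left multiples and the resultant with an operator of order two -/

section Resultant

variable {C E : Type*} [CommRing C] [CommRing E] [Algebra C E] (d : Derivation C E E)

theorem delMul_add (P Q : E[X]) : delMul d (P + Q) = delMul d P + delMul d Q := by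
  simp only [delMul, map_add]; ring

theorem delMul_sub (P Q : E[X]) : delMul d (P - Q) = delMul d P - delMul d Q := by
  simp only [delMul, map_sub]; ring

theorem coeffDer_C (a : E) : coeffDer d (Polynomial.C a) = Polynomial.C (d a) := by
  ext i
  rw [coeff_coeffDer, Polynomial.coeff_C, Polynomial.coeff_C]
  split_ifs <;> simp

theorem coeffDer_X : coeffDer d (Polynomial.X : E[X]) = 0 := by
  ext i
  rw [coeff_coeffDer, Polynomial.coeff_X]
  split_ifs <;> simp

theorem delMul_C_mul (a : E) (P : E[X]) :
    delMul d (Polynomial.C a * P) = Polynomial.C a * delMul d P + Polynomial.C (d a) * P := by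
  simp only [delMul, Derivation.leibniz, coeffDer_C, smul_eq_mul]; ring

theorem coeff_iterate_delMul_eq_zero {P : E[X]} {n : ℕ} (hP : P.natDegree ≤ n) (k : ℕ) {j : ℕ}
    (hj : n + k < j) : ((delMul d)^[k] P).coeff j = 0 := by
  induction k generalizing j with
  | zero => exact Polynomial.coeff_eq_zero_of_natDegree_lt (by simpa using hP.trans_lt hj)
  | succ k ih =>
    obtain ⟨j, rfl⟩ : ∃ i, j = i + 1 := ⟨j - 1, by omega⟩
    rw [Function.iterate_succ_apply', delMul, Polynomial.coeff_add, Polynomial.coeff_X_mul,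
      coeff_coeffDer, ih (by omega), ih (by omega), map_zero, add_zero]

theorem coeff_iterate_delMul_top {P : E[X]} {n : ℕ} (hP : P.natDegree ≤ n) (k : ℕ) :
    ((delMul d)^[k] P).coeff (n + k) = P.coeff n := by
  induction k with
  | zero => rfl
  | succ k ih =>
    rw [Function.iterate_succ_apply', delMul, Polynomial.coeff_add, ← add_assoc,
      Polynomial.coeff_X_mul, coeff_coeffDer, ih, coeff_iterate_delMul_eq_zero d hP k (by omega),
      map_zero, add_zero]

/-- The operators `∑_{i < k} aᵢ ∂ⁱ P`, the left multiples of `P` by operators of order `< k`. -/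
noncomputable def leftMul (P : E[X]) (k : ℕ) : Submodule E E[X] :=
  Submodule.span E (Set.range fun i : Fin k => (delMul d)^[(i : ℕ)] P)

theorem iterate_mem_leftMul (P : E[X]) {i k : ℕ} (h : i < k) :
    (delMul d)^[i] P ∈ leftMul d P k :=
  Submodule.subset_span ⟨⟨i, h⟩, rfl⟩

theorem leftMul_mono (P : E[X]) {k l : ℕ} (h : k ≤ l) : leftMul d P k ≤ leftMul d P l := by
  refine Submodule.span_le.2 ?_
  rintro _ ⟨i, rfl⟩
  exact iterate_mem_leftMul d P (i.2.trans_le h)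

theorem C_mul_mem_leftMul {P Q : E[X]} {k : ℕ} (a : E) (h : Q ∈ leftMul d P k) :
    Polynomial.C a * Q ∈ leftMul d P k := by
  rw [← Polynomial.smul_eq_C_mul]
  exact Submodule.smul_mem _ _ h

theorem delMul_mem_leftMul {P Q : E[X]} {k : ℕ} (h : Q ∈ leftMul d P k) :
    delMul d Q ∈ leftMul d P (k + 1) := by
  induction h using Submodule.span_induction with
  | mem x hx =>
    obtain ⟨i, rfl⟩ := hx
    simp only
    rw [← Function.iterate_succ_apply' (delMul d)]
    exact iterate_mem_leftMul d P (by omega)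
  | zero => simp [delMul]
  | add x y _ _ hx hy => rw [delMul_add]; exact add_mem hx hy
  | smul a x hx h =>
    rw [Polynomial.smul_eq_C_mul, delMul_C_mul]
    exact add_mem (C_mul_mem_leftMul d a h)
      (C_mul_mem_leftMul d _ (leftMul_mono d P k.le_succ hx))

theorem opMul_mem_leftMul {P Q : E[X]} {k : ℕ} (h : Q.natDegree < k) :
    opMul d Q P ∈ leftMul d P k := by
  rw [opMul, Polynomial.sum]
  refine sum_mem fun i hi => C_mul_mem_leftMul d _ (iterate_mem_leftMul d P ?_)
  exact (Polynomial.le_natDegree_of_mem_supp i hi).trans_lt h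

/-- The differential resultant with an operator of order two and leading coefficient `a`, computed
from the remainders of `∂ Q` and `Q`. -/
theorem dRes_eq_of_remainders {P Q R₀ R₁ : E[X]} (hP : P.natDegree = 2)
    (h₀ : Q - R₀ ∈ leftMul d P Q.natDegree) (h₁ : delMul d Q - R₁ ∈ leftMul d P Q.natDegree)
    (hR₀ : R₀.natDegree ≤ 1) (hR₁ : R₁.natDegree ≤ 1) :
    dRes d P Q = P.coeff 2 ^ Q.natDegree *
      (R₁.coeff 1 * R₀.coeff 0 - R₁.coeff 0 * R₀.coeff 1) := by
  set m := Q.natDegree with hm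
  obtain ⟨q₀, hq₀⟩ := (Submodule.mem_span_range_iff_exists_fun E).1 h₀
  obtain ⟨q₁, hq₁⟩ := (Submodule.mem_span_range_iff_exists_fun E).1 h₁
  rw [dRes, hP, ← hm]
  let A : Matrix (Fin m) (Fin m) E :=
    Matrix.of fun i j => ((delMul d)^[(i.rev : ℕ)] P).coeff (2 + (j.rev : ℕ))
  let B : Matrix (Fin m) (Fin 2) E :=
    Matrix.of fun i j => ((delMul d)^[(i.rev : ℕ)] P).coeff (j.rev : ℕ)
  -- The order matches the last two rows of the Sylvester matrix, `∂Q` above `Q`.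
  let r : Fin 2 → E[X] := ![R₁, R₀]
  let q : Fin 2 → Fin m → E := ![q₁, q₀]
  let S : Matrix (Fin 2) (Fin 2) E := Matrix.of fun i j => (r i).coeff (j.rev : ℕ)
  let T : Matrix (Fin 2) (Fin m) E := Matrix.of fun i j => q i j.rev
  have hrev (i : Fin m) : ((Fin.castAdd 2 i).rev : ℕ) = 2 + (i.rev : ℕ) := by
    simp only [Fin.val_rev, Fin.val_castAdd]; omega
  have hrev' (i : Fin 2) : ((Fin.natAdd m i).rev : ℕ) = (i.rev : ℕ) := by
    simp only [Fin.val_rev, Fin.val_natAdd]; omega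
  have hsum (q : Fin m → E) (j : ℕ) :
      (∑ i, q i • (delMul d)^[(i : ℕ)] P).coeff j =
        ∑ i : Fin m, q i.rev * ((delMul d)^[(i.rev : ℕ)] P).coeff j := by
    rw [← Equiv.sum_comp Fin.revPerm]
    simp [Polynomial.finsetSum_coeff]
  have hq (i : Fin 2) :
      ∑ k, q i k • (delMul d)^[(k : ℕ)] P = (delMul d)^[(i.rev : ℕ)] Q - r i := by
    fin_cases i
    · exact hq₁
    · exact hq₀
  have he (i : Fin 2) (j : ℕ) : ((delMul d)^[(i.rev : ℕ)] Q).coeff j =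
      ∑ k : Fin m, q i k.rev * ((delMul d)^[(k.rev : ℕ)] P).coeff j + (r i).coeff j := by
    rw [← hsum, hq, Polynomial.coeff_sub, sub_add_cancel]
  have hr (i : Fin 2) (j : ℕ) : (r i).coeff (2 + j) = 0 := by
    refine Polynomial.coeff_eq_zero_of_natDegree_lt ?_
    fin_cases i <;> simp [r] <;> omega
  have hl (i : Fin m) (j : Fin (m + 2)) : sylvester d 2 m P Q (Fin.castAdd 2 i) j =
      ((delMul d)^[(i.rev : ℕ)] P).coeff (j.rev : ℕ) := by
    rw [sylvester, Matrix.of_apply, Fin.addCases_left]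
  have hr' (i : Fin 2) (j : Fin (m + 2)) : sylvester d 2 m P Q (Fin.natAdd m i) j =
      ((delMul d)^[(i.rev : ℕ)] Q).coeff (j.rev : ℕ) := by
    rw [sylvester, Matrix.of_apply, Fin.addCases_right]
  -- Subtracting combinations of the `P` rows replaces `∂Q`, `Q` by remainders of order at most one,
  -- which occupy only the last two columns. The factor with `T` is this unimodular row operation.
  have hblock : (sylvester d 2 m P Q).submatrix finSumFinEquiv finSumFinEquiv =
      Matrix.fromBlocks 1 0 T 1 * Matrix.fromBlocks A B 0 S := by
    rw [Matrix.fromBlocks_multiply]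
    simp only [Matrix.one_mul, Matrix.zero_mul, Matrix.mul_zero, add_zero]
    ext (i | i) (j | j)
    · simp only [Matrix.submatrix_apply, finSumFinEquiv_apply_left, hl, hrev,
        Matrix.fromBlocks_apply₁₁, A, Matrix.of_apply]
    · simp only [Matrix.submatrix_apply, finSumFinEquiv_apply_left, finSumFinEquiv_apply_right, hl,
        hrev', Matrix.fromBlocks_apply₁₂, B, Matrix.of_apply]
    · simp only [Matrix.submatrix_apply, finSumFinEquiv_apply_left, finSumFinEquiv_apply_right, hr',
        hrev, he, hr, Matrix.fromBlocks_apply₂₁, Matrix.mul_apply, A, T, Matrix.of_apply, add_zero]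
    · simp only [Matrix.submatrix_apply, finSumFinEquiv_apply_right, hr',
        hrev', he, Matrix.fromBlocks_apply₂₂, Matrix.mul_apply, Matrix.add_apply, B, S, T,
        Matrix.of_apply]
  have hA : A.det = P.coeff 2 ^ m := by
    rw [Matrix.det_of_isUpperTriangular]
    · simp only [A, Matrix.of_apply, coeff_iterate_delMul_top d hP.le]
      simp
    · intro i j hij
      refine coeff_iterate_delMul_eq_zero d hP.le _ ?_
      have : (j : ℕ) < i := hij
      simp only [Fin.val_rev]
      omega
  rw [← Matrix.det_submatrix_equiv_self finSumFinEquiv, hblock, Matrix.det_mul,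
    Matrix.det_fromBlocks_zero₁₂, Matrix.det_fromBlocks_zero₂₁, hA, Matrix.det_one, Matrix.det_one,
    Matrix.det_fin_two]
  simp [S, r]

end Resultant

/-! ### Products of operators: constants, orders, and change of coefficients -/

section DiffOp

variable {C E : Type*} [CommRing C] [CommRing E] [Algebra C E] (d : Derivation C E E)

theorem natDegree_coeffDer_le (p : E[X]) : (coeffDer d p).natDegree ≤ p.natDegree := by
  refine Polynomial.natDegree_le_iff_coeff_eq_zero.2 fun N hN => ?_
  rw [coeff_coeffDer, Polynomial.coeff_eq_zero_of_natDegree_lt hN, map_zero]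

theorem opMul_eq_sum {P : E[X]} {N : ℕ} (hP : P.natDegree < N) (Q : E[X]) :
    opMul d P Q = ∑ i ∈ Finset.range N, Polynomial.C (P.coeff i) * (delMul d)^[i] Q :=
  Polynomial.sum_over_range' P (fun i => by simp) N hP

theorem iterate_delMul_sub (P Q : E[X]) (i : ℕ) :
    (delMul d)^[i] (P - Q) = (delMul d)^[i] P - (delMul d)^[i] Q := by
  induction i with
  | zero => rfl
  | succ i ih => simp only [Function.iterate_succ_apply', ih, delMul_sub]

theorem iterate_delMul_C {a : E} (ha : d a = 0) (i : ℕ) :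
    (delMul d)^[i] (Polynomial.C a) = Polynomial.C a * Polynomial.X ^ i := by
  induction i with
  | zero => simp
  | succ i ih =>
    have hX : coeffDer d (Polynomial.X ^ i : E[X]) = 0 := by
      rw [Derivation.leibniz_pow, coeffDer_X, smul_zero, smul_zero]
    rw [Function.iterate_succ_apply', ih, delMul_C_mul, ha, delMul, hX, map_zero]
    ring

/-- A constant commutes with `∂`, so it is central enough to be moved to the left of `P`. -/
theorem opMul_sub_C (P Q : E[X]) {a : E} (ha : d a = 0) :
    opMul d P (Q - Polynomial.C a) = opMul d P Q - Polynomial.C a * P := by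
  have hP := P.as_sum_range
  rw [opMul_eq_sum d P.natDegree.lt_succ_self, opMul_eq_sum d P.natDegree.lt_succ_self]
  nth_rewrite 5 [hP]
  rw [Finset.mul_sum, ← Finset.sum_sub_distrib]
  refine Finset.sum_congr rfl fun i _ => ?_
  rw [iterate_delMul_sub, iterate_delMul_C d ha, ← Polynomial.C_mul_X_pow_eq_monomial]
  ring

theorem natDegree_opMul_le {P Q : E[X]} {m n : ℕ} (hP : P.natDegree ≤ m) (hQ : Q.natDegree ≤ n) :
    (opMul d P Q).natDegree ≤ n + m := by
  refine Polynomial.natDegree_le_iff_coeff_eq_zero.2 fun N hN => ?_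
  rw [opMul_eq_sum d (Nat.lt_succ_of_le hP), Polynomial.finsetSum_coeff]
  refine Finset.sum_eq_zero fun i hi => ?_
  have := Finset.mem_range.1 hi
  rw [Polynomial.coeff_C_mul, coeff_iterate_delMul_eq_zero d hQ i (by omega), mul_zero]

theorem coeff_opMul_top {P Q : E[X]} {m n : ℕ} (hP : P.natDegree ≤ m) (hQ : Q.natDegree ≤ n) :
    (opMul d P Q).coeff (n + m) = P.coeff m * Q.coeff n := by
  rw [opMul_eq_sum d (Nat.lt_succ_of_le hP), Polynomial.finsetSum_coeff, Finset.sum_range_succ,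
    Polynomial.coeff_C_mul, coeff_iterate_delMul_top d hQ, Finset.sum_eq_zero, zero_add]
  intro i hi
  have := Finset.mem_range.1 hi
  rw [Polynomial.coeff_C_mul, coeff_iterate_delMul_eq_zero d hQ i (by omega), mul_zero]

theorem natDegree_schrodinger_le (a : E) : (schrodinger a).natDegree ≤ 2 := by
  unfold schrodinger; compute_degree

theorem coeff_two_schrodinger (a : E) : (schrodinger a).coeff 2 = -1 := by
  simp [schrodinger]

section Map

variable {A : Type*} [CommRing A] [Algebra C A] (δ : Derivation C A A) (ψ : E →ₐ[C] A)
  (hψ : ∀ f, ψ (d f) = δ (ψ f))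

include hψ

theorem map_iterate_delMul (Q : E[X]) (i : ℕ) :
    ((delMul d)^[i] Q).map (ψ : E →+* A) = (delMul δ)^[i] (Q.map (ψ : E →+* A)) := by
  have h1 (p : E[X]) : (coeffDer d p).map (ψ : E →+* A) = coeffDer δ (p.map (ψ : E →+* A)) := by
    ext i
    simp only [Polynomial.coeff_map, coeff_coeffDer, RingHom.coe_coe, hψ]
  induction i with
  | zero => rfl
  | succ i ih =>
    rw [Function.iterate_succ_apply', Function.iterate_succ_apply', ← ih, delMul, delMul,
      Polynomial.map_add, Polynomial.map_mul, Polynomial.map_X, h1]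

theorem map_opMul (P Q : E[X]) :
    (opMul d P Q).map (ψ : E →+* A) =
      opMul δ (P.map (ψ : E →+* A)) (Q.map (ψ : E →+* A)) := by
  rw [opMul_eq_sum d P.natDegree.lt_succ_self,
    opMul_eq_sum δ (Nat.lt_succ_of_le Polynomial.natDegree_map_le), Polynomial.map_sum]
  refine Finset.sum_congr rfl fun i _ => ?_
  rw [Polynomial.map_mul, Polynomial.map_C, map_iterate_delMul d δ ψ hψ, Polynomial.coeff_map]

theorem aevalTower_coeffDer {a : A} (ha : δ a = 0) (p : E[X]) :
    Polynomial.aevalTower ψ a (coeffDer d p) =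
      δ (Polynomial.aevalTower ψ a p) := by
  have hpow (n : ℕ) : coeffDer d (Polynomial.X ^ n : E[X]) = 0 := by
    rw [Derivation.leibniz_pow, coeffDer_X, smul_zero, smul_zero]
  have hpow' (n : ℕ) : δ (a ^ n) = 0 := by
    rw [Derivation.leibniz_pow, ha, smul_zero, smul_zero]
  induction p using Polynomial.induction_on' with
  | add p q hp hq => simp only [map_add, hp, hq]
  | monomial n e =>
    rw [← Polynomial.C_mul_X_pow_eq_monomial, Derivation.leibniz, hpow, coeffDer_C]
    simp only [smul_eq_mul, mul_zero, zero_add, map_mul, map_pow, Polynomial.aevalTower_C,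
      Polynomial.aevalTower_X, Derivation.leibniz, hpow', hψ]

end Map

end DiffOp

/-! ### The generating polynomial in `λ` and its first integral -/

section Hierarchy

variable {C : Type*} [Field C]

variable (C) in
theorem natDegree_opP_le (n : ℕ) : (opP C n).natDegree ≤ 2 * n + 1 := by
  induction n with
  | zero => exact Polynomial.natDegree_X_le
  | succ n ih =>
    have h := natDegree_opMul_le (D C) ih (natDegree_schrodinger_le (U C))
    refine Polynomial.natDegree_add_le_of_degree_le
      ((Polynomial.natDegree_sub_le _ _).trans (max_le ?_ ?_)) (h.trans (by omega))
    · exact (Polynomial.natDegree_C_mul_le _ _).trans (Polynomial.natDegree_X_le.trans (by omega))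
    · rw [Polynomial.natDegree_C]; omega

variable (C) in
theorem coeff_opP (n : ℕ) : (opP C n).coeff (2 * n + 1) = (-1) ^ n := by
  induction n with
  | zero => simp [opP]
  | succ n ih =>
    have h := coeff_opMul_top (D C) (natDegree_opP_le C n) (natDegree_schrodinger_le (U C))
    have e : 2 * (n + 1) + 1 = 2 + (2 * n + 1) := by ring
    rw [opP, Polynomial.coeff_add, Polynomial.coeff_sub, e, h, ih, coeff_two_schrodinger,
      Polynomial.coeff_C_mul, Polynomial.coeff_X_of_ne_one (by omega),
      Polynomial.coeff_C_of_ne_zero (by omega)]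
    ring

theorem natDegree_opPhat_le {n : ℕ} (c : Fin n → C) : (opPhat c).natDegree ≤ 2 * n + 1 := by
  refine Polynomial.natDegree_add_le_of_degree_le (natDegree_opP_le C n) ?_
  refine Polynomial.natDegree_sum_le_of_forall_le _ _ fun l _ => ?_
  refine (Polynomial.natDegree_smul_le _ _).trans ((natDegree_opP_le C l).trans ?_)
  have := l.2
  omega

theorem coeff_opPhat {n : ℕ} (c : Fin n → C) : (opPhat c).coeff (2 * n + 1) = (-1) ^ n := by
  rw [opPhat, Polynomial.coeff_add, coeff_opP, Polynomial.finsetSum_coeff, Finset.sum_eq_zero,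
    add_zero]
  intro l _
  rw [Polynomial.coeff_smul, Polynomial.coeff_eq_zero_of_natDegree_lt, smul_zero]
  refine (natDegree_opP_le C l).trans_lt ?_
  have := l.2
  omega

variable (C) in
/-- The polynomial `∑_{k ≤ n} vₖ λⁿ⁻ᵏ` in `λ`. -/
noncomputable def vPoly : ℕ → (DPoly C)[X]
  | 0 => 1
  | n + 1 => Polynomial.X * vPoly n + Polynomial.C (v C (n + 1))

/-- The polynomial `Fₙ + ∑_{l < n} cₙ₋ₗ Fₗ`, where `Fₙ` is `vPoly C n`. -/
noncomputable def vPolyHat {n : ℕ} (c : Fin n → C) : (DPoly C)[X] :=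
  vPoly C n + ∑ l : Fin n, c l.rev • vPoly C l

variable (C) in
theorem natDegree_vPoly_le (n : ℕ) : (vPoly C n).natDegree ≤ n := by
  induction n with
  | zero => simp [vPoly]
  | succ n ih =>
    refine Polynomial.natDegree_add_le_of_degree_le ?_ (by simp)
    exact Polynomial.natDegree_mul_le.trans (by
      have : (Polynomial.X : (DPoly C)[X]).natDegree ≤ 1 := Polynomial.natDegree_X_le
      omega)

theorem coeff_vPoly (n : ℕ) : (vPoly C n).coeff n = 1 := by
  induction n with
  | zero => simp [vPoly]
  | succ n ih =>
    rw [vPoly, Polynomial.coeff_add, Polynomial.coeff_X_mul, ih,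
      Polynomial.coeff_C_of_ne_zero (by omega), add_zero]

theorem natDegree_vPolyHat_le {n : ℕ} (c : Fin n → C) : (vPolyHat c).natDegree ≤ n := by
  refine Polynomial.natDegree_add_le_of_degree_le (natDegree_vPoly_le C n) ?_
  refine Polynomial.natDegree_sum_le_of_forall_le _ _ fun l _ => ?_
  exact (Polynomial.natDegree_smul_le _ _).trans ((natDegree_vPoly_le C l).trans l.2.le)

theorem coeff_vPolyHat {n : ℕ} (c : Fin n → C) : (vPolyHat c).coeff n = 1 := by
  rw [vPolyHat, Polynomial.coeff_add, coeff_vPoly, Polynomial.finsetSum_coeff,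
    Finset.sum_eq_zero, add_zero]
  intro l _
  rw [Polynomial.coeff_smul, Polynomial.coeff_eq_zero_of_natDegree_lt, smul_zero]
  exact (natDegree_vPoly_le C l).trans_lt l.2

/-- The polynomial `(1/2) F F'' - (1/4) F'² - (u - λ) F²` in `λ`. -/
noncomputable def curvePoly (F : (DPoly C)[X]) : (DPoly C)[X] :=
  (1 / 2 : C) • (F * coeffDer (D C) (coeffDer (D C) F)) - (1 / 4 : C) • (coeffDer (D C) F) ^ 2 -
    (Polynomial.C (U C) - Polynomial.X) * F ^ 2

theorem monic_natDegree_curvePoly {F : (DPoly C)[X]} {n : ℕ} (hF : F.natDegree ≤ n)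
    (hn : F.coeff n = 1) : (curvePoly F).Monic ∧ (curvePoly F).natDegree = 2 * n + 1 := by
  have h1 := (natDegree_coeffDer_le (D C) F).trans hF
  have h2 := (natDegree_coeffDer_le (D C) _).trans h1
  have hFm : F.Monic := Polynomial.monic_of_natDegree_le_of_coeff_eq_one n hF hn
  have hFd : F.natDegree = n := le_antisymm hF (Polynomial.le_natDegree_of_ne_zero (by simp [hn]))
  have hM : (Polynomial.X * F ^ 2).Monic := Polynomial.monic_X.mul (hFm.pow 2)
  have hMd : (Polynomial.X * F ^ 2).natDegree = 2 * n + 1 := by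
    rw [Polynomial.monic_X.natDegree_mul (hFm.pow 2), Polynomial.natDegree_X, hFm.natDegree_pow,
      hFd, add_comm]
  let G : (DPoly C)[X] := (1 / 2 : C) • (F * coeffDer (D C) (coeffDer (D C) F)) -
    (1 / 4 : C) • (coeffDer (D C) F) ^ 2 - Polynomial.C (U C) * F ^ 2
  have hG : G.natDegree ≤ 2 * n := by
    refine (Polynomial.natDegree_sub_le _ _).trans
      (max_le ((Polynomial.natDegree_sub_le _ _).trans (max_le ?_ ?_)) ?_)
    · exact (Polynomial.natDegree_smul_le _ _).trans (Polynomial.natDegree_mul_le.trans (by omega))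
    · refine (Polynomial.natDegree_smul_le _ _).trans (Polynomial.natDegree_pow_le.trans ?_)
      omega
    · refine (Polynomial.natDegree_C_mul_le _ _).trans (Polynomial.natDegree_pow_le.trans ?_)
      omega
  -- Only `λ F²` reaches degree `2n + 1`; everything else has degree at most `2n`.
  have e : curvePoly F = Polynomial.X * F ^ 2 + G := by simp only [curvePoly, G]; ring
  have hlt : G.natDegree < (Polynomial.X * F ^ 2).natDegree := by omega
  rw [e]
  exact ⟨hM.add_of_left (Polynomial.degree_lt_degree hlt),
    (Polynomial.natDegree_add_eq_left_of_natDegree_lt hlt).trans hMd⟩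

theorem coeffDer_smul (a : C) (F : (DPoly C)[X]) :
    coeffDer (D C) (a • F) = a • coeffDer (D C) F := Derivation.map_smul _ _ _

/-- The operator `-(1/4) ∂³ + (u - λ) ∂ + (1/2) u'` on polynomials in `λ`. -/
noncomputable def lenardPoly (F : (DPoly C)[X]) : (DPoly C)[X] :=
  -((1 / 4 : C) • coeffDer (D C) (coeffDer (D C) (coeffDer (D C) F))) +
    (Polynomial.C (U C) - Polynomial.X) * coeffDer (D C) F +
    (1 / 2 : C) • (Polynomial.C (D C (U C)) * F)

/-- Here `lenardPoly` is `lenard - λ ∂` coefficientwise, and `∂vₖ₊₁ = lenard vₖ` cancels all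
positive powers of `λ`. -/
theorem lenardPoly_vPoly [CharZero C] (n : ℕ) :
    lenardPoly (vPoly C n) = Polynomial.C (D C (v C (n + 1))) := by
  induction n with
  | zero =>
    rw [D_v_succ]
    simp [lenardPoly, lenard, vPoly, v, Polynomial.smul_C]
  | succ n ih =>
    have e : lenardPoly (vPoly C (n + 1)) = Polynomial.X * lenardPoly (vPoly C n) +
        Polynomial.C (lenard (v C (n + 1))) - Polynomial.X * Polynomial.C (D C (v C (n + 1))) := by
      simp only [lenardPoly, vPoly, lenard, map_add, Derivation.leibniz, coeffDer_X, coeffDer_C,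
        smul_eq_mul, map_neg, map_mul, ← Polynomial.smul_C, mul_zero, add_zero]
      simp only [Algebra.smul_def]
      ring
    rw [e, ih, D_v_succ (n + 1)]
    ring

theorem lenardPoly_vPolyHat [CharZero C] {n : ℕ} (c : Fin n → C) :
    (2 : C) • lenardPoly (vPolyHat c) = Polynomial.C (KdVPoly c) := by
  have hadd (F G : (DPoly C)[X]) : lenardPoly (F + G) = lenardPoly F + lenardPoly G := by
    simp only [lenardPoly, map_add, mul_add, smul_add, neg_add]
    ring
  have hsmul (a : C) (F : (DPoly C)[X]) : lenardPoly (a • F) = a • lenardPoly F := by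
    simp only [lenardPoly, coeffDer_smul, mul_smul_comm]
    module
  let T : (DPoly C)[X] →ₗ[C] (DPoly C)[X] := ⟨⟨lenardPoly, hadd⟩, hsmul⟩
  have h (k : ℕ) : (2 : C) • T (vPoly C k) = Polynomial.C (kdv C k) := by
    rw [kdv_eq, ← Polynomial.smul_C, ← lenardPoly_vPoly]
    rfl
  change (2 : C) • T (vPolyHat c) = _
  rw [vPolyHat, KdVPoly, map_add, map_add, smul_add, h, map_sum, map_sum, Finset.smul_sum]
  congr 1
  refine Finset.sum_congr rfl fun l _ => ?_
  rw [map_smul, smul_comm, h, Polynomial.smul_C]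

/-- In the derivative the terms `F'F''` cancel, and every remaining term has the factor `F`. -/
theorem coeffDer_curvePoly [CharZero C] (F : (DPoly C)[X]) :
    coeffDer (D C) (curvePoly F) = -(F * ((2 : C) • lenardPoly F)) := by
  simp only [curvePoly, lenardPoly, map_sub, coeffDer_smul, Derivation.leibniz, coeffDer_X,
    coeffDer_C, smul_eq_mul, pow_two, sub_zero]
  simp only [Algebra.smul_def]
  have e4 : algebraMap C (DPoly C)[X] (1 / 4) * 2 = algebraMap C (DPoly C)[X] (1 / 2) := by
    rw [← map_ofNat (algebraMap C (DPoly C)[X]) 2, ← map_mul]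
    norm_num
  have e2 : algebraMap C (DPoly C)[X] (1 / 2) * 2 = 1 := by
    rw [← map_ofNat (algebraMap C (DPoly C)[X]) 2, ← map_mul]
    norm_num
  rw [map_ofNat]
  set a := algebraMap C (DPoly C)[X] (1 / 4)
  set b := algebraMap C (DPoly C)[X] (1 / 2)
  generalize coeffDer (D C) (coeffDer (D C) (coeffDer (D C) F)) = F3
  generalize coeffDer (D C) (coeffDer (D C) F) = F2
  generalize coeffDer (D C) F = F1
  linear_combination (-F1 * F2 - F * F3) * e4 + F ^ 2 * Polynomial.C (D C (U C)) * e2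

theorem isFirstIntegral_curvePoly [CharZero C] {n : ℕ} (c : Fin n → C) (i : ℕ) :
    IsFirstIntegral (KdVPoly c) ((curvePoly (vPolyHat c)).coeff i) := by
  have h := congrArg (fun p => Polynomial.coeff p i) (coeffDer_curvePoly (vPolyHat c))
  simp only [lenardPoly_vPolyHat, coeff_coeffDer, Polynomial.coeff_neg,
    Polynomial.coeff_mul_C] at h
  rw [IsFirstIntegral, h]
  exact neg_mem (Ideal.mul_mem_left _ _ (Ideal.subset_span ⟨0, rfl⟩))

end Hierarchy

/-! ### The remainder of `P̂` modulo `L - λ` and the value of the resultant -/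

section Resultant

variable {C A : Type*} [Field C] [CommRing A] [Algebra C A] (δ : Derivation C A A)
  (ψ : DPoly C →ₐ[C] A) (hψ : ∀ f, ψ (D C f) = δ (ψ f)) {a b : A} (ha : δ a = 0) (hb : δ b = 0)

/-- The operator `f ∂ - (1/2) f'`. -/
noncomputable def firstOrder (f : A) : A[X] :=
  Polynomial.C f * Polynomial.X - Polynomial.C ((1 / 2 : C) • δ f)

theorem firstOrder_add (f g : A) : firstOrder δ (f + g) = firstOrder δ f + firstOrder δ g := by
  simp only [firstOrder, map_add, smul_add]; ring

theorem firstOrder_smul (c : C) (f : A) : firstOrder δ (c • f) = c • firstOrder δ f := by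
  simp only [firstOrder, Derivation.map_smul, smul_comm _ c, ← Polynomial.smul_C, smul_sub,
    smul_mul_assoc]

include ha in
theorem firstOrder_mul (f : A) : firstOrder δ (a * f) = Polynomial.C a * firstOrder δ f := by
  rw [firstOrder, Derivation.leibniz, ha, smul_zero, add_zero, smul_eq_mul, ← mul_smul_comm,
    Polynomial.C_mul, Polynomial.C_mul, firstOrder]
  ring

include hψ ha

/-- Induction on the splitting `P₂ₙ₊₁ L = P₂ₙ₊₁ (L - a) + a P₂ₙ₊₁`: the first term is a left
multiple of `L - a`, and the second matches the Horner recursion of `vPoly`. -/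
theorem map_opP_sub_mem (n : ℕ) :
    (opP C n).map (ψ : DPoly C →+* A) - firstOrder δ (Polynomial.aevalTower ψ a (vPoly C n)) ∈
      leftMul δ (schrodinger (ψ (U C)) - Polynomial.C a) (2 * n) := by
  induction n with
  | zero => simp [opP, vPoly, firstOrder]
  | succ n ih =>
    set Q := (opP C n).map (ψ : DPoly C →+* A) with hQ
    set f := Polynomial.aevalTower ψ a (vPoly C n)
    have hL : (schrodinger (U C)).map (ψ : DPoly C →+* A) = schrodinger (ψ (U C)) := by
      simp [schrodinger]
    have h1 : (opP C (n + 1)).map (ψ : DPoly C →+* A) =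
        firstOrder δ (ψ (v C (n + 1))) + opMul δ Q (schrodinger (ψ (U C))) := by
      rw [opP, Polynomial.map_add, map_opMul _ δ ψ hψ, hL, firstOrder, Polynomial.map_sub,
        Polynomial.map_mul, Polynomial.map_X, Polynomial.map_C, Polynomial.map_C, RingHom.coe_coe,
        map_smul, hψ]
    have h2 : firstOrder δ (Polynomial.aevalTower ψ a (vPoly C (n + 1))) =
        Polynomial.C a * firstOrder δ f + firstOrder δ (ψ (v C (n + 1))) := by
      rw [vPoly, map_add, map_mul, Polynomial.aevalTower_X, Polynomial.aevalTower_C,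
        firstOrder_add, firstOrder_mul δ ha]
    have h3 : (opP C (n + 1)).map (ψ : DPoly C →+* A) -
        firstOrder δ (Polynomial.aevalTower ψ a (vPoly C (n + 1))) =
        opMul δ Q (schrodinger (ψ (U C)) - Polynomial.C a) +
          Polynomial.C a * (Q - firstOrder δ f) := by
      rw [h1, h2, opMul_sub_C δ _ _ ha]
      ring
    rw [h3]
    refine add_mem (opMul_mem_leftMul δ ?_)
      (C_mul_mem_leftMul δ a (leftMul_mono δ _ (by omega) ih))
    exact (Polynomial.natDegree_map_le.trans (natDegree_opP_le C n)).trans_lt (by omega)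

theorem map_opPhat_sub_mem {n : ℕ} (c : Fin n → C) :
    (opPhat c).map (ψ : DPoly C →+* A) - firstOrder δ (Polynomial.aevalTower ψ a (vPolyHat c)) ∈
      leftMul δ (schrodinger (ψ (U C)) - Polynomial.C a) (2 * n) := by
  let T : A →ₗ[C] A[X] := ⟨⟨firstOrder δ, firstOrder_add δ⟩, firstOrder_smul δ⟩
  let S := (leftMul δ (schrodinger (ψ (U C)) - Polynomial.C a) (2 * n)).restrictScalars C
  have e : (opPhat c).map (ψ : DPoly C →+* A) -
      T (Polynomial.aevalTower ψ a (vPolyHat c)) =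
      ((opP C n).map (ψ : DPoly C →+* A) - T (Polynomial.aevalTower ψ a (vPoly C n))) +
      ∑ l : Fin n, c l.rev • ((opP C l).map (ψ : DPoly C →+* A) -
        T (Polynomial.aevalTower ψ a (vPoly C l))) := by
    have hs (r : C) (p : (DPoly C)[X]) :
        (r • p).map (ψ : DPoly C →+* A) = r • p.map (ψ : DPoly C →+* A) := by
      ext i
      simp
    simp only [opPhat, vPolyHat, map_add, map_sum, map_smul, Polynomial.map_add,
      Polynomial.map_sum, hs, smul_sub, Finset.sum_sub_distrib]
    abel
  change _ - T _ ∈ S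
  rw [e]
  refine add_mem (map_opP_sub_mem δ ψ hψ ha n) (sum_mem fun l _ => S.smul_mem _ ?_)
  exact leftMul_mono δ _ (by have := l.2; omega) (map_opP_sub_mem δ ψ hψ ha l)

include hb

/-- The differential resultant of `L - a` and `P - b`, for constants `a` and `b`. -/
theorem dRes_schrodinger_opPhat [CharZero C] [Nontrivial A] {n : ℕ} (c : Fin n → C) :
    dRes δ (schrodinger (ψ (U C)) - Polynomial.C a)
      ((opPhat c).map (ψ : DPoly C →+* A) - Polynomial.C b) =
      -b ^ 2 - Polynomial.aevalTower ψ a (curvePoly (vPolyHat c)) := by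
  set P := schrodinger (ψ (U C)) - Polynomial.C a with hP
  set Q := (opPhat c).map (ψ : DPoly C →+* A) - Polynomial.C b with hQ
  set f := Polynomial.aevalTower ψ a (vPolyHat c) with hf
  have hP2 : P.coeff 2 = -1 := by
    rw [hP, Polynomial.coeff_sub, coeff_two_schrodinger,
      Polynomial.coeff_C_of_ne_zero (by norm_num), sub_zero]
  have hPd : P.natDegree = 2 := by
    refine le_antisymm ?_ (Polynomial.le_natDegree_of_ne_zero (by simp [hP2]))
    rw [hP, Polynomial.natDegree_sub_C]
    exact natDegree_schrodinger_le _
  have hQd : Q.natDegree = 2 * n + 1 := by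
    rw [hQ, Polynomial.natDegree_sub_C]
    refine le_antisymm (Polynomial.natDegree_map_le.trans (natDegree_opPhat_le c)) ?_
    refine Polynomial.le_natDegree_of_ne_zero ?_
    rw [Polynomial.coeff_map, coeff_opPhat]
    rcases neg_one_pow_eq_or (DPoly C) n with h | h <;> simp [h]
  -- `R₀` is `f ∂ - f'/2 - b`, and `R₁` is `∂ R₀` with `∂²` replaced by `u - a`; the difference is
  -- the multiple `-f (L - a)`.
  let R₀ := Polynomial.C f * Polynomial.X + Polynomial.C (-((1 / 2 : C) • δ f) - b)
  let R₁ := Polynomial.C ((1 / 2 : C) • δ f - b) * Polynomial.X +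
    Polynomial.C (f * (ψ (U C) - a) - (1 / 2 : C) • δ (δ f))
  have hmem : Q - R₀ ∈ leftMul δ P (2 * n) := by
    have := map_opPhat_sub_mem δ ψ hψ ha c
    convert this using 1
    simp only [hQ, R₀, firstOrder, ← hf, map_sub, map_neg]
    ring
  have hhalf : δ f - (1 / 2 : C) • δ f = (1 / 2 : C) • δ f := by
    module
  have hR : delMul δ R₀ - R₁ = Polynomial.C (-f) * P := by
    have e : delMul δ R₀ - R₁ = Polynomial.C f * Polynomial.X ^ 2 +
        Polynomial.C (δ f - (1 / 2 : C) • δ f - (1 / 2 : C) • δ f) * Polynomial.X -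
        Polynomial.C (f * (ψ (U C) - a)) := by
      simp only [delMul, R₀, R₁, Derivation.leibniz, map_add, map_sub, map_neg, coeffDer_C,
        coeffDer_X, smul_eq_mul, hb, Derivation.map_smul, map_zero]
      ring
    rw [e, hhalf, sub_self, hP, schrodinger]
    simp only [map_zero, map_mul, map_sub, map_neg]
    ring
  have hmem₁ : delMul δ Q - R₁ ∈ leftMul δ P (2 * n + 1) := by
    have e : delMul δ Q - R₁ = delMul δ (Q - R₀) + (delMul δ R₀ - R₁) := by
      rw [delMul_sub δ Q R₀]; ring
    rw [e, hR]
    exact add_mem (delMul_mem_leftMul δ hmem)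
      (C_mul_mem_leftMul δ _ (iterate_mem_leftMul δ P (i := 0) (by omega)))
  have hdeg (x y : A) :
      (Polynomial.C x * Polynomial.X + Polynomial.C y).natDegree ≤ 1 := by
    compute_degree
  -- The prefactor is `(-1)²ⁿ⁺¹ = -1`, and the determinant is `b² - f'²/4 + ff''/2 - (u - a) f²`.
  rw [dRes_eq_of_remainders δ hPd (R₀ := R₀) (R₁ := R₁)
    (by rw [hQd]; exact leftMul_mono δ P (by omega) hmem) (by rw [hQd]; exact hmem₁)
    (hdeg _ _) (hdeg _ _), hP2, hQd]
  have hcurve : Polynomial.aevalTower ψ a (curvePoly (vPolyHat c)) =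
      (1 / 2 : C) • (f * δ (δ f)) - (1 / 4 : C) • δ f ^ 2 - (ψ (U C) - a) * f ^ 2 := by
    simp only [curvePoly, map_sub, map_mul, map_smul, map_pow, Polynomial.aevalTower_C,
      Polynomial.aevalTower_X, aevalTower_coeffDer (D C) δ ψ hψ ha, ← hf]
  have h4 : (1 / 4 : C) • δ f ^ 2 = ((1 / 2 : C) • δ f) ^ 2 := by
    rw [smul_pow]; norm_num
  rw [hcurve, h4, ← mul_smul_comm]
  simp only [R₀, R₁, Polynomial.coeff_add, Polynomial.coeff_C_mul, Polynomial.coeff_X_one,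
    Polynomial.coeff_X_zero, Polynomial.coeff_C_zero, Polynomial.coeff_C_succ, mul_one, mul_zero,
    add_zero, zero_add, pow_succ (-1 : A) (2 * n), pow_mul, neg_one_sq, one_pow]
  ring

end Resultant

/-! ### The resultant over `E[λ, μ]` -/

section Spectral

variable {C E : Type*} [Field C] [CharZero C] [CommRing E] [Nontrivial E] [Algebra C E]
  (d : Derivation C E E) (φ : DPoly C →ₐ[C] E) (hφ : ∀ f, φ (D C f) = d (φ f))

include hφ

theorem specRes_schrodinger_opPhat {n : ℕ} (c : Fin n → C) :
    specRes d (schrodinger (φ (U C))) ((opPhat c).map (φ : DPoly C →+* E)) =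
      -Polynomial.X ^ 2 -
        Polynomial.C ((curvePoly (vPolyHat c)).map (φ : DPoly C →+* E)) := by
  -- The general computation is applied over `E[λ, μ]`, where `a = λ` and `b = μ` are constants of
  -- the extended derivation.
  let ψ : DPoly C →ₐ[C] E[X][X] := (Polynomial.CAlgHom.comp Polynomial.CAlgHom).comp φ
  have hψ (f : DPoly C) : ψ (D C f) = coeffDer (coeffDer d) (ψ f) := by
    have h : coeffDer (coeffDer d) (Polynomial.C (Polynomial.C (φ f))) =
        Polynomial.C (Polynomial.C (φ (D C f))) := by
      rw [coeffDer_C, coeffDer_C, hφ]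
    exact h.symm
  have h := dRes_schrodinger_opPhat (coeffDer (coeffDer d)) ψ hψ
    (a := Polynomial.C Polynomial.X) (b := Polynomial.X)
    (by rw [coeffDer_C, coeffDer_X, map_zero]) (coeffDer_X _) c
  have e1 : (schrodinger (φ (U C))).map (Polynomial.C.comp Polynomial.C) =
      schrodinger (ψ (U C)) := by
    simp [schrodinger, ψ]
  have e2 : ((opPhat c).map (φ : DPoly C →+* E)).map (Polynomial.C.comp Polynomial.C) =
      (opPhat c).map (ψ : DPoly C →+* E[X][X]) := by
    rw [Polynomial.map_map]; rfl
  have e3 (p : (DPoly C)[X]) : Polynomial.aevalTower ψ (Polynomial.C Polynomial.X) p =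
      Polynomial.C (p.map (φ : DPoly C →+* E)) := by
    induction p using Polynomial.induction_on' with
    | add p q hp hq => simp only [map_add, Polynomial.map_add, hp, hq]
    | monomial n e => simp [← Polynomial.C_mul_X_pow_eq_monomial, ψ]
  rw [specRes, e1, e2, h, e3]

end Spectral

/-! ### Irreducibility and the spectral curve -/

section Irreducible

variable {F : Type*} [Field F]

/-- Up to sign this is a monic quadratic in `μ`, so it is reducible only if it has a root `p` in
`F[λ]`; then `R = -p²` would have even degree. -/
theorem irreducible_neg_X_sq_sub_C {R : F[X]} (hR : Odd R.natDegree) :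
    Irreducible (-Polynomial.X ^ 2 - Polynomial.C R : F[X][X]) := by
  have e : (-Polynomial.X ^ 2 - Polynomial.C R : F[X][X]) =
      -(Polynomial.X ^ 2 - Polynomial.C (-R)) := by rw [map_neg]; ring
  rw [e]
  refine (Associated.refl (Polynomial.X ^ 2 - Polynomial.C (-R))).neg_left.irreducible_iff.2 ?_
  rw [(Polynomial.monic_X_pow_sub_C _ two_ne_zero).irreducible_iff_roots_eq_zero_of_degree_le_three
      (by rw [Polynomial.natDegree_X_pow_sub_C])
      (by rw [Polynomial.natDegree_X_pow_sub_C]; norm_num)]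
  refine Multiset.eq_zero_of_forall_notMem fun p hp => ?_
  have hp := Polynomial.isRoot_of_mem_roots hp
  simp only [Polynomial.IsRoot.def, Polynomial.eval_sub, Polynomial.eval_pow, Polynomial.eval_X,
    Polynomial.eval_C, sub_neg_eq_add] at hp
  have h : R = -p ^ 2 := by linear_combination hp
  rw [h, Polynomial.natDegree_neg, Polynomial.natDegree_pow] at hR
  exact (Nat.not_odd_iff_even.2 (even_two_mul _)) hR

/-- A square-free part `f` is divisible by `g`; an irreducible factor of the cofactor would divide
`g` too, and its square would divide `f`. -/
theorem isSquarefreePart_iff_associated {A : Type*} [CommRing A] [IsDomain A]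
    [UniqueFactorizationMonoid A] {f g : A} (hg : Irreducible g) :
    IsSquarefreePart f g ↔ Associated f g := by
  constructor
  · rintro ⟨hf, h⟩
    obtain ⟨k, rfl⟩ := (h g hg).2 dvd_rfl
    have hk : IsUnit k := by
      by_contra hk
      have hk0 : k ≠ 0 := by
        rintro rfl
        rw [mul_zero] at hf
        exact not_squarefree_zero hf
      obtain ⟨q, hq, hqk⟩ := WfDvdMonoid.exists_irreducible_factor hk hk0
      have hqg : q ∣ g := (h q hq).1 (hqk.mul_left g)
      exact hq.1 (hf q (mul_dvd_mul hqg hqk))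
    exact (associated_mul_unit_left g k hk)
  · intro h
    exact ⟨(h.squarefree_iff).2 hg.squarefree, fun q _ => h.dvd_iff_dvd_right⟩

/-- The lift of the resultant to `C[λ, μ]` is unique, and its square-free part is unique up to a
unit, so the zero set does not depend on the choices in `spectralCurve`. -/
theorem spectralCurve_eq {K : Type*} [Field K] [Algebra F K] (d : Derivation F K K) {P Q : K[X]}
    {f : F[X][X]} (hf : Irreducible f)
    (h : f.map (Polynomial.mapRingHom (algebraMap F K)) = specRes d P Q) :
    spectralCurve d P Q = {p : F × F | f.evalEval p.1 p.2 = 0} := by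
  have hinj : Function.Injective
      (Polynomial.map (Polynomial.mapRingHom (algebraMap F K)) : F[X][X] → K[X][X]) :=
    Polynomial.map_injective _ (Polynomial.map_injective _ (algebraMap F K).injective)
  ext p
  constructor
  · rintro ⟨g, g', hg', hg, hp⟩
    obtain rfl := hinj (hg'.trans h.symm)
    obtain ⟨k, hk⟩ := ((isSquarefreePart_iff_associated hf).1 hg).dvd
    change Polynomial.evalEval p.1 p.2 g' = 0
    rw [hk, Polynomial.evalEval_mul, hp, zero_mul]
  · intro hp
    exact ⟨f, f, h, (isSquarefreePart_iff_associated hf).2 (Associated.refl f), hp⟩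

end Irreducible

/-! ### Specialization to a potential and the main theorem -/

section Potential

variable {C K : Type*} [Field C] [Field K] [Algebra C K] (d : Derivation C K K) (w : K)

theorem subst_D (f : DPoly C) : subst d w (D C f) = d (subst d w f) := by
  induction f using MvPolynomial.induction_on with
  | C a => simp [D, subst]
  | add p q hp hq => simp [hp, hq]
  | mul_X p i hp =>
    have hX (j : ℕ) : subst d w (MvPolynomial.X j : DPoly C) = d^[j] w := by simp [subst]
    rw [Derivation.leibniz, map_add, smul_eq_mul, smul_eq_mul, map_mul, map_mul, map_mul, hp, D_X,
      Derivation.leibniz, hX, hX, Function.iterate_succ_apply', smul_eq_mul, smul_eq_mul]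

theorem subst_U : subst d w (U C) = w := by
  simp [subst, U]

end Potential

end KdV

theorem mainTheorem2 {C K : Type*} [Field C] [IsAlgClosed C] [Field K] [CharZero K] [Algebra C K]
    (d : Derivation C K K) (hconst : ∀ x : K, d x = 0 → x ∈ Set.range (algebraMap C K))
    (w : K) (s : ℕ) (hs : KdV.IsKdVPotential d w s)
    (c : Fin s → C) (hc : c ∈ KdV.solutionConstants d w s) :
    ∃ (f : Polynomial (Polynomial C)) (R : Polynomial C),
      f.map (Polynomial.mapRingHom (algebraMap C K)) =
        KdV.specRes d (KdV.schrodinger w) (KdV.opA d w c) ∧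
      f = -Polynomial.X ^ 2 - Polynomial.C R ∧
      R.natDegree = 2 * s + 1 ∧
      Irreducible (KdV.specRes d (KdV.schrodinger w) (KdV.opA d w c)) ∧
      KdV.spectralCurve d (KdV.schrodinger w) (KdV.opA d w c) =
        {p : C × C | f.evalEval p.1 p.2 = 0} ∧
      ∃ Rform : Polynomial (KdV.DPoly C),
        KdV.specRes (KdV.D C) (KdV.schrodinger (KdV.U C)) (KdV.opPhat c) =
          -Polynomial.X ^ 2 - Polynomial.C Rform ∧
        Rform.map (KdV.subst d w : KdV.DPoly C →+* K) = R.map (algebraMap C K) ∧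
        ∀ i : ℕ, KdV.IsFirstIntegral (KdV.KdVPoly c) (Rform.coeff i) := by
  have : CharZero C := (algebraMap C K).charZero
  set G := KdV.curvePoly (KdV.vPolyHat c)
  obtain ⟨hGm, hGd⟩ :=
    KdV.monic_natDegree_curvePoly (KdV.natDegree_vPolyHat_le c) (KdV.coeff_vPolyHat c)
  have hspec := KdV.specRes_schrodinger_opPhat d (KdV.subst d w) (KdV.subst_D d w) c
  rw [KdV.subst_U] at hspec
  change KdV.specRes d (KdV.schrodinger w) (KdV.opA d w c) = _ at hspec
  -- The formal resultant is the same computation with the identity substitution, so a single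
  -- polynomial `G` serves both cases.
  have hformal := KdV.specRes_schrodinger_opPhat (KdV.D C) (AlgHom.id C (KdV.DPoly C))
    (fun _ => rfl) c
  have hid : ((AlgHom.id C (KdV.DPoly C) : KdV.DPoly C →ₐ[C] KdV.DPoly C) :
      KdV.DPoly C →+* KdV.DPoly C) = RingHom.id _ := rfl
  rw [hid, Polynomial.map_id, Polynomial.map_id, AlgHom.id_apply] at hformal
  have hlift : G.map (KdV.subst d w : KdV.DPoly C →+* K) ∈ Polynomial.lifts (algebraMap C K) := by
    rw [Polynomial.lifts_iff_coeff_lifts]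
    intro i
    -- The derivative of each coefficient of `G` is a multiple of the KdV polynomial, which vanishes
    -- at `w`; so the specialized coefficient is a constant of `K`.
    refine hconst _ ?_
    have h := congrArg (fun p => KdV.subst d w (p.coeff i))
      (KdV.coeffDer_curvePoly (KdV.vPolyHat c))
    simp only [KdV.lenardPoly_vPolyHat, KdV.coeff_coeffDer, Polynomial.coeff_neg,
      Polynomial.coeff_mul_C, KdV.subst_D, map_neg, map_mul] at h
    rw [show KdV.subst d w (KdV.KdVPoly c) = 0 from hc, mul_zero, neg_zero] at h
    rw [Polynomial.coeff_map]
    exact h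
  obtain ⟨R, hR⟩ := (Polynomial.mem_lifts _).1 hlift
  have hRd : R.natDegree = 2 * s + 1 := by
    rw [← Polynomial.natDegree_map (algebraMap C K) (p := R), hR, hGm.natDegree_map, hGd]
  have hmap : (-Polynomial.X ^ 2 - Polynomial.C R : Polynomial (Polynomial C)).map
      (Polynomial.mapRingHom (algebraMap C K)) =
      KdV.specRes d (KdV.schrodinger w) (KdV.opA d w c) := by
    rw [hspec, ← hR]
    simp
  refine ⟨_, R, hmap, rfl, hRd, ?_, KdV.spectralCurve_eq d
    (KdV.irreducible_neg_X_sq_sub_C ⟨s, hRd⟩) hmap, G, hformal, hR.symm,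
    KdV.isFirstIntegral_curvePoly c⟩
  rw [hspec]
  refine KdV.irreducible_neg_X_sq_sub_C ⟨s, ?_⟩
  rw [hGm.natDegree_map, hGd]
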